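/- Let $q,d\in\mathbb R$ with $0<q<d\le 2q$, and let $W=(W_t)_{t\in[q,d]}$ be a $(q,d)$-Slepian process, i.e. a centered (stationary) Gaussian process with continuous sample paths and covariance $\operatorname{Cov}(W_s,W_{s+u})=(1-\tfrac{u}{q})^+$ for $q\le s\le s+u\le d$. Let $n\ge 1$ and let $q=t_0<t_1<\dots<t_n=d$, and put $$c:=\frac{q^{(n+1)/2}}{2^{n}\pi^{(n+1)/2}\sqrt{(3q-d)(d-q)}}.$$ Let $g:[q,d]\to\mathbb R$ be measurable and, for $i=0,\dots,n-1$, let $p_i:\mathbb R^2\to\mathbb R$ be any measurable version of the conditional (Slepian-bridge non-crossing) probability $$p_i(x,y)=\mathbb P\bigl(W_t\le g(t)\ \forall t\in(t_i,t_{i+1})\,\big|\,W_{t_i}=x,\;W_{t_{i+1}}=y\bigr),$$ i.e. $p_i(W_{t_i},W_{t_{i+1}})$ is almost surely equal to the conditional probability of the event $\{W_t\le g(t)\ \forall t\in(t_i,t_{i+1})\}$ given $\sigma(W_{t_i},W_{t_{i+1}})$. Set $$F(x_0,\dots,x_n)=\exp\Bigl[-\frac q4\Bigl(\frac{(x_0+x_n)^2}{3q-d}+\frac{(x_0-x_n)^2}{d-q}\Bigr)\Bigr]\;p_0(x_0,x_1)\prod_{i=1}^{n-1}p_i(x_i,x_{i+1})\exp\Bigl[-\frac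 q4\Bigl(\frac{(x_i-x_0)^2}{t_i-q}+\frac{(x_{i+1}-x_i)^2}{t_{i+1}-t_i}-\frac{(x_{i+1}-x_0)^2}{t_{i+1}-q}\Bigr)\Bigr].$$ Then $F$ is Lebesgue integrable on $\{x\in\mathbb R^{n+1}: x_i\le g(t_i),\ i=0,\dots,n\}$, and $$\mathbb P\bigl(W_t>g(t)\text{ for some }t\in[q,d]\bigr)=1-c\prod_{i=1}^{n-1}\frac{\sqrt{t_{i+1}-q}}{\sqrt{(t_{i+1}-t_i)(t_i-q)}}\int_{-\infty}^{g(t_0)}\int_{-\infty}^{g(t_n)}\int_{-\infty}^{g(t_{n-1})}\cdots\int_{-\infty}^{g(t_1)}F(x_0,\dots,x_n)\,dx_1\cdots dx_{n-1}\,dx_n\,dx_0.$$ -/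

import Mathlib

open MeasureTheory ProbabilityTheory

noncomputable section

/-- `W = (W_t)_{t ∈ [q,d]}` is a `(q,d)`-Slepian process on the probability space `(Ω, P)`: a centered
Gaussian process of (measurable) real random variables with continuous sample paths and covariance
`Cov(W_s, W_{s+u}) = (1 - u/q)⁺` for `q ≤ s ≤ s + u ≤ d`. Stationarity is implied, since mean and
covariance determine the law of a Gaussian process and are invariant under time shifts. -/
structure IsSlepianProcess {Ω : Type*} [MeasurableSpace Ω] (q d : ℝ)
    (W : Set.Icc q d → Ω → ℝ) (P : Measure Ω) : Prop where
  measurable : ∀ t, Measurable (W t)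
  isGaussianProcess : IsGaussianProcess W P
  centered : ∀ t, ∫ ω, W t ω ∂P = 0
  covariance_eq : ∀ s t : Set.Icc q d, s ≤ t →
    cov[W s, W t; P] = max (1 - ((t : ℝ) - (s : ℝ)) / q) 0
  continuous_paths : ∀ ω, Continuous (fun t => W t ω)

/-- The measurable function `p` is a version of the conditional probability `x ↦ P(A | X = x)`, that
is, `p ∘ X` is a version of the conditional expectation of the indicator of `A` given `σ(X)`. -/
def IsCondProbGiven {Ω β : Type*} [MeasurableSpace Ω] [mβ : MeasurableSpace β]
    (P : Measure Ω) (A : Set Ω) (X : Ω → β) (p : β → ℝ) : Prop :=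
  Measurable p ∧
    (fun ω => p (X ω)) =ᵐ[P] P[A.indicator (fun _ => (1 : ℝ)) | MeasurableSpace.comap X mβ]

/-- The iterated integral
`∫_{-∞}^{b_{k-1}} ⋯ ∫_{-∞}^{b_0} F(y_0, …, y_{k-1}) dy_0 ⋯ dy_{k-1}`
(`y_0` innermost, `y_{k-1}` outermost). -/
def iteratedIntegralIic : (k : ℕ) → (Fin k → ℝ) → ((Fin k → ℝ) → ℝ) → ℝ
  | 0, _, F => F Fin.elim0
  | k + 1, b, F =>
      ∫ z in Set.Iic (b (Fin.last k)),
        iteratedIntegralIic k (fun i => b i.castSucc)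
          (fun y => F (Fin.snoc (α := fun _ => ℝ) y z))

/-- The constant `c = q^{(n+1)/2} / (2^n π^{(n+1)/2} √((3q-d)(d-q)))`. -/
def slepianConst (q d : ℝ) (n : ℕ) : ℝ :=
  q ^ (((n : ℝ) + 1) / 2) /
    (2 ^ n * Real.pi ^ (((n : ℝ) + 1) / 2) * Real.sqrt ((3 * q - d) * (d - q)))

/-- The integrand, as a function of `x = (x_0, …, x_n)`. The function `p i` stands for
`(x_i, x_{i+1}) ↦ P(W_s ≤ g(s) ∀ s ∈ (t_i, t_{i+1}) | W_{t_i} = x_i, W_{t_{i+1}} = x_{i+1})`,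
`i = 0, …, n - 1`; the last product runs over `i = 1, …, n - 1`. -/
def slepianIntegrand (q d : ℝ) (n : ℕ) (t : Fin (n + 1) → ℝ) (p : Fin n → ℝ × ℝ → ℝ)
    (x : Fin (n + 1) → ℝ) : ℝ :=
  Real.exp (-(q / 4) * ((x 0 + x (Fin.last n)) ^ 2 / (3 * q - d)
      + (x 0 - x (Fin.last n)) ^ 2 / (d - q)))
  * (∏ i : Fin n, p i (x i.castSucc, x i.succ))
  * ∏ i ∈ Finset.univ.filter (fun i : Fin n => 0 < (i : ℕ)),
      Real.exp (-(q / 4) * ((x i.castSucc - x 0) ^ 2 / (t i.castSucc - q)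
        + (x i.succ - x i.castSucc) ^ 2 / (t i.succ - t i.castSucc)
        - (x i.succ - x 0) ^ 2 / (t i.succ - q)))

end

/-!
The covariance `1 - |s - t| / q` of the process is piecewise affine on `[q, d]`, because `d ≤ 2q`
makes the positive part irrelevant. Two facts about Gaussian processes follow from this.

*Bridges.* The residual of `W` on `(tᵢ, tᵢ₊₁)` after subtraction of the chord joining `W_{tᵢ}` to
`W_{tᵢ₊₁}` is uncorrelated with every value of `W` outside `(tᵢ, tᵢ₊₁)`
(`IsSlepianProcess.covariance_bridge_eq_zero`). Hence the bridges over different intervals are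
independent of each other and of the skeleton `(W_{t₀}, …, W_{tₙ})`. The non-crossing events are
therefore conditionally independent given the skeleton, and the probability that `W` stays below `g`
is the integral of `∏ pᵢ` against the law of the skeleton over the orthant `xᵢ ≤ g(tᵢ)`
(`measureReal_inter_iInter_eq_setIntegral_prod`). No fine measurability theory is needed for the
events: for continuous paths the constraint `W ≤ g` on a set of times is equivalent to the constraint
on a countable subset of it (`exists_countable_subset_forall_le_iff`).

*Density of the skeleton.* The end sum `W_{t₀} + W_{tₙ}` and the increments `W_{tᵢ₊₁} - W_{tᵢ}` are
pairwise uncorrelated, hence independent, with variances `2(3q - d)/q` and `2(tᵢ₊₁ - tᵢ)/q`. The map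
`x ↦ (x₀ + xₙ, x₁ - x₀, …, xₙ - xₙ₋₁)` has determinant `2`, which gives the density of the skeleton
(`IsSlepianProcess.map_skeleton`). The exponentials and square roots of the statement telescope to
this density (`skeletonDensity_eq`). It is everywhere positive, so that the versions `pᵢ`, which are
determined only almost surely under the law of the skeleton, are determined Lebesgue almost everywhere
and take values in `[0, 1]` there. Integrability of the integrand and Fubini's theorem follow.
-/

/-! ### Continuous paths and countably many constraints -/

/-- For continuous functions on a compact metric space the constraints `f s ≤ g s`, `s ∈ S`, can be
reduced to countably many, whatever the function `g`: each constraint is closed in `C(T, ℝ)`, a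
second countable space. -/
theorem exists_countable_subset_forall_le_iff {T : Type*} [MetricSpace T] [CompactSpace T]
    (g : T → ℝ) (S : Set T) :
    ∃ S' ⊆ S, S'.Countable ∧
      ∀ f : T → ℝ, Continuous f → ((∀ s ∈ S', f s ≤ g s) ↔ ∀ s ∈ S, f s ≤ g s) := by
  obtain ⟨S', hS', hc, hU⟩ := TopologicalSpace.isOpen_biUnion_countable S
    (fun s => {f : C(T, ℝ) | g s < f s})
    (fun s _ => isOpen_lt continuous_const (continuous_eval_const s))
  refine ⟨S', hS', hc, fun f hf => ⟨fun h s hs => ?_, fun h s hs => h s (hS' hs)⟩⟩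
  by_contra! hlt
  have : (⟨f, hf⟩ : C(T, ℝ)) ∈ ⋃ i ∈ S', {f : C(T, ℝ) | g i < f i} := by
    rw [hU]
    exact Set.mem_biUnion hs hlt
  simp only [Set.mem_iUnion, Set.mem_ofPred_eq, exists_prop, ContinuousMap.coe_mk] at this
  obtain ⟨r, hr, hlt'⟩ := this
  exact absurd (h r hr) (not_le.mpr hlt')

/-! ### Conditionally independent events -/

section CondIndep

variable {Ω : Type*} [MeasurableSpace Ω] {P : Measure Ω} [IsProbabilityMeasure P]

/-- If `R` is independent of `Y`, a version of the conditional probability of `(Y, R) ∈ C` given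
`Y = y` is obtained by freezing `Y` at the value `y`. -/
theorem IsCondProbGiven.ae_eq_of_indepFun {β γ : Type*} [MeasurableSpace β] [MeasurableSpace γ]
    {Y : Ω → β} {R : Ω → γ} (hY : Measurable Y) (hR : Measurable R) (hYR : IndepFun Y R P)
    {C : Set (β × γ)} (hC : MeasurableSet C) {p : β → ℝ}
    (hp : IsCondProbGiven P {ω | (Y ω, R ω) ∈ C} Y p) :
    ∀ᵐ ω ∂P, p (Y ω) = (P.map R).real (Prod.mk (Y ω) ⁻¹' C) := by
  have : IsProbabilityMeasure (P.map R) := Measure.isProbabilityMeasure_map hR.aemeasurable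
  have : IsProbabilityMeasure (P.map Y) := Measure.isProbabilityMeasure_map hY.aemeasurable
  have hm : Measurable fun y => (P.map R).real (Prod.mk y ⁻¹' C) :=
    (measurable_measure_prodMk_left hC).ennreal_toReal
  have hA : MeasurableSet {ω | (Y ω, R ω) ∈ C} := (hY.prodMk hR) hC
  have hint : Integrable (fun ω => (P.map R).real (Prod.mk (Y ω) ⁻¹' C)) P :=
    Integrable.of_bound (hm.comp hY).aestronglyMeasurable 1
      (.of_forall fun ω => by
        rw [Real.norm_of_nonneg measureReal_nonneg]
        exact measureReal_le_one)
  have key : (fun ω => (P.map R).real (Prod.mk (Y ω) ⁻¹' C)) =ᵐ[P]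
      P[{ω | (Y ω, R ω) ∈ C}.indicator (fun _ => (1 : ℝ)) | MeasurableSpace.comap Y inferInstance] := by
    refine ae_eq_condExp_of_forall_setIntegral_eq hY.comap_le
      ((integrable_const 1).indicator hA) (fun _ _ _ => hint.integrableOn) ?_
      (Measurable.aestronglyMeasurable (hm.comp (comap_measurable Y)))
    rintro _ ⟨D, hD, rfl⟩ -
    have h1 : P (Y ⁻¹' D ∩ {ω | (Y ω, R ω) ∈ C})
        = ∫⁻ ω in Y ⁻¹' D, (P.map R) (Prod.mk (Y ω) ⁻¹' C) ∂P := by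
      have h2 : P (Y ⁻¹' D ∩ {ω | (Y ω, R ω) ∈ C})
          = (P.map fun ω => (Y ω, R ω)) (Prod.fst ⁻¹' D ∩ C) := by
        rw [Measure.map_apply (hY.prodMk hR) ((measurable_fst hD).inter hC)]
        rfl
      rw [h2, (indepFun_iff_map_prod_eq_prod_map_map hY.aemeasurable hR.aemeasurable).1 hYR,
        Measure.prod_apply ((measurable_fst hD).inter hC),
        ← setLIntegral_map hD (measurable_measure_prodMk_left hC) hY,
        ← lintegral_indicator hD]
      refine lintegral_congr fun y => ?_
      by_cases hy : y ∈ D <;> simp [Set.indicator, hy, Set.preimage_inter, ← Set.preimage_comp,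
        Function.comp_def]
    rw [integral_indicator hA, Measure.restrict_restrict hA, Set.inter_comm]
    simp only [integral_const, smul_eq_mul, mul_one, measureReal_restrict_apply_univ]
    rw [Measure.real, h1, integral_eq_lintegral_of_nonneg_ae (.of_forall fun _ => measureReal_nonneg)
      (hm.comp hY).aestronglyMeasurable]
    simp only [measureReal_def, ENNReal.ofReal_toReal (measure_ne_top _ _)]
  exact hp.2.trans key.symm

/-- If `X, R₀, R₁, …` are independent and the `i`-th event depends only on `Y i X` and `R i`, then
the events are conditionally independent given `X`, and the `i`-th conditional probability depends
on `X` through `Y i X` only. Hence the probability of their intersection with `X ∈ B` is the integral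
over `B` of the product of the conditional probabilities. -/
theorem measureReal_inter_iInter_eq_setIntegral_prod {ι : Type*} [Fintype ι] {E : Type*}
    [MeasurableSpace E] {β γ : ι → Type*} [∀ i, MeasurableSpace (β i)] [∀ i, MeasurableSpace (γ i)]
    {X : Ω → E} (hX : Measurable X) {Y : ∀ i, E → β i} (hY : ∀ i, Measurable (Y i))
    {R : ∀ i, Ω → γ i} (hR : ∀ i, Measurable (R i))
    (hXR : IndepFun X (fun ω i => R i ω) P) (hRR : iIndepFun R P)
    {C : ∀ i, Set (β i × γ i)} (hC : ∀ i, MeasurableSet (C i)) {p : ∀ i, β i → ℝ}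
    (hp : ∀ i, IsCondProbGiven P {ω | (Y i (X ω), R i ω) ∈ C i} (fun ω => Y i (X ω)) (p i))
    {B : Set E} (hB : MeasurableSet B) :
    (∀ᵐ x ∂(P.map X), ∀ i, p i (Y i x) ∈ Set.Icc (0 : ℝ) 1) ∧
    P.real (X ⁻¹' B ∩ ⋂ i, {ω | (Y i (X ω), R i ω) ∈ C i})
      = ∫ x in B, ∏ i, p i (Y i x) ∂(P.map X) := by
  have hprob (i) : IsProbabilityMeasure (P.map (R i)) :=
    Measure.isProbabilityMeasure_map (hR i).aemeasurable
  have hYX (i) : Measurable fun ω => Y i (X ω) := (hY i).comp hX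
  have hRm : Measurable fun ω i => R i ω := measurable_pi_lambda _ hR
  have hq (i) : Measurable fun y => (P.map (R i)) (Prod.mk y ⁻¹' C i) :=
    measurable_measure_prodMk_left (hC i)
  have hae : ∀ᵐ x ∂(P.map X), ∀ i,
      p i (Y i x) = (P.map (R i)).real (Prod.mk (Y i x) ⁻¹' C i) := by
    rw [ae_all_iff]
    intro i
    have hind : IndepFun (fun ω => Y i (X ω)) (R i) P :=
      hXR.comp (hY i) (measurable_pi_apply i)
    rw [ae_map_iff hX.aemeasurable]
    · exact (hp i).ae_eq_of_indepFun (hYX i) (hR i) hind (hC i)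
    · exact measurableSet_eq_fun ((hp i).1.comp (hY i)) ((hq i).ennreal_toReal.comp (hY i))
  refine ⟨hae.mono fun x hx i => ?_, ?_⟩
  · rw [hx i]
    exact ⟨measureReal_nonneg, measureReal_le_one⟩
  set D : Set (E × ∀ i, γ i) := Prod.fst ⁻¹' B ∩ ⋂ i, {z | (Y i z.1, z.2 i) ∈ C i} with hD_def
  have hD : MeasurableSet D := by
    refine (measurable_fst hB).inter (MeasurableSet.iInter fun i => ?_)
    exact (((hY i).comp measurable_fst).prodMk
      ((measurable_pi_apply i).comp measurable_snd)) (hC i)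
  have h1 : P (X ⁻¹' B ∩ ⋂ i, {ω | (Y i (X ω), R i ω) ∈ C i})
      = ∫⁻ x in B, ∏ i, (P.map (R i)) (Prod.mk (Y i x) ⁻¹' C i) ∂(P.map X) := by
    have h2 : P (X ⁻¹' B ∩ ⋂ i, {ω | (Y i (X ω), R i ω) ∈ C i})
        = (P.map fun ω => (X ω, fun i => R i ω)) D := by
      rw [Measure.map_apply (hX.prodMk hRm) hD]
      congr 1
      ext ω
      simp [hD_def]
    have : IsProbabilityMeasure (P.map fun ω i => R i ω) :=
      Measure.isProbabilityMeasure_map hRm.aemeasurable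
    rw [h2, (indepFun_iff_map_prod_eq_prod_map_map hX.aemeasurable hRm.aemeasurable).1 hXR,
      Measure.prod_apply hD, ← lintegral_indicator hB]
    refine lintegral_congr fun x => ?_
    by_cases hx : x ∈ B
    · have : Prod.mk x ⁻¹' D = Set.univ.pi fun i => Prod.mk (Y i x) ⁻¹' C i := by
        ext r
        simp [hD_def, hx]
      rw [this, hRR.map_fun_eq_pi_map fun i => (hR i).aemeasurable, Measure.pi_pi,
        Set.indicator_of_mem hx]
    · have : Prod.mk x ⁻¹' D = ∅ := by
        ext r
        simp [hD_def, hx]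
      rw [this, Set.indicator_of_notMem hx, measure_empty]
  have h3 : ∫ x in B, ∏ i, p i (Y i x) ∂(P.map X)
      = ∫ x in B, ∏ i, (P.map (R i)).real (Prod.mk (Y i x) ⁻¹' C i) ∂(P.map X) := by
    refine integral_congr_ae (ae_restrict_of_ae (hae.mono fun x hx => ?_))
    exact Finset.prod_congr rfl fun i _ => hx i
  rw [h3, Measure.real, h1, integral_eq_lintegral_of_nonneg_ae]
  · congr 1
    refine lintegral_congr fun x => ?_
    rw [ENNReal.ofReal_prod_of_nonneg fun _ _ => measureReal_nonneg]
    simp only [measureReal_def, ENNReal.ofReal_toReal (measure_ne_top _ _)]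
  · exact .of_forall fun x => Finset.prod_nonneg fun _ _ => measureReal_nonneg
  · exact (Finset.measurable_prod _ fun i _ =>
      (hq i).ennreal_toReal.comp (hY i)).aestronglyMeasurable

end CondIndep

/-! ### Iterated integrals over orthants -/

/-- Fubini's theorem for an integral over an orthant, with the `j`-th variable outermost. -/
theorem setIntegral_orthant_insertNth {k : ℕ} (j : Fin (k + 1)) (b : Fin (k + 1) → ℝ)
    {F : (Fin (k + 1) → ℝ) → ℝ} (hF : IntegrableOn F {y | ∀ i, y i ≤ b i}) :
    (∀ᵐ z, z ∈ Set.Iic (b j) → IntegrableOn (fun y => F (j.insertNth (α := fun _ => ℝ) z y))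
      {y | ∀ i, y i ≤ b (j.succAbove i)}) ∧
    ∫ y in {y | ∀ i, y i ≤ b i}, F y = ∫ z in Set.Iic (b j),
      ∫ y in {y | ∀ i, y i ≤ b (j.succAbove i)}, F (j.insertNth (α := fun _ => ℝ) z y) := by
  have hms (m : ℕ) (c : Fin m → ℝ) : MeasurableSet {y : Fin m → ℝ | ∀ i, y i ≤ c i} :=
    measurableSet_Iic (a := c)
  set S : Set (Fin (k + 1) → ℝ) := {y | ∀ i, y i ≤ b i} with hS
  set S' : Set (Fin k → ℝ) := {y | ∀ i, y i ≤ b (j.succAbove i)} with hS'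
  have hG : Integrable (S.indicator F) := (integrable_indicator_iff (hms _ b)).2 hF
  have hmp := (volume_preserving_piFinSuccAbove (fun _ : Fin (k + 1) => ℝ) j).symm
  have hGz (z : ℝ) (y : Fin k → ℝ) : S.indicator F (j.insertNth (α := fun _ => ℝ) z y) =
      (Set.Iic (b j)).indicator
        (fun z => S'.indicator (fun y => F (j.insertNth (α := fun _ => ℝ) z y)) y) z := by
    have : j.insertNth (α := fun _ => ℝ) z y ∈ S ↔ z ∈ Set.Iic (b j) ∧ y ∈ S' := by
      simp [hS, hS', Fin.forall_iff_succAbove j]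
    by_cases h1 : z ∈ Set.Iic (b j) <;> by_cases h2 : y ∈ S' <;>
      simp only [Set.indicator, this, h1, h2, and_true, and_false, if_true, if_false]
  have hG2 : Integrable (fun w : ℝ × (Fin k → ℝ) =>
      S.indicator F (j.insertNth (α := fun _ => ℝ) w.1 w.2)) (volume.prod volume) :=
    (hmp.integrable_comp_emb (MeasurableEquiv.measurableEmbedding _)).2 hG
  constructor
  · filter_upwards [hG2.prod_right_ae] with z hz hzb
    rw [← integrable_indicator_iff (hms _ _)]
    refine hz.congr (.of_forall fun y => ?_)
    simp only [hGz, Set.indicator_of_mem hzb]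
    rfl
  · rw [← integral_indicator (hms _ b), ← hmp.integral_comp (MeasurableEquiv.measurableEmbedding _),
      ← integral_indicator measurableSet_Iic]
    refine (integral_prod _ hG2).trans (integral_congr_ae (.of_forall fun z => ?_))
    simp only [hGz]
    by_cases h1 : z ∈ Set.Iic (b j)
    · simp only [Set.indicator_of_mem h1]
      exact integral_indicator (hms _ _)
    · simp only [Set.indicator_of_notMem h1, integral_zero]

theorem iteratedIntegralIic_eq_setIntegral (k : ℕ) (b : Fin k → ℝ) (F : (Fin k → ℝ) → ℝ)
    (hF : IntegrableOn F {y | ∀ i, y i ≤ b i}) :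
    iteratedIntegralIic k b F = ∫ y in {y | ∀ i, y i ≤ b i}, F y := by
  induction k with
  | zero =>
    have : {y : Fin 0 → ℝ | ∀ i, y i ≤ b i} = Set.univ := by
      ext y
      simp
    rw [this, Measure.restrict_univ, volume_pi, Measure.pi_of_empty _ Fin.elim0, integral_dirac]
    rfl
  | succ k ih =>
    obtain ⟨h1, h2⟩ := setIntegral_orthant_insertNth (Fin.last k) b hF
    rw [h2, iteratedIntegralIic]
    refine setIntegral_congr_ae measurableSet_Iic (h1.mono fun z hz hzb => ?_)
    have := hz hzb
    simp only [Fin.succAbove_last, Fin.insertNth_last'] at this ⊢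
    exact ih _ _ this

/-! ### Products of densities and linear changes of variables -/

theorem pi_withDensity_ofReal {ι : Type*} [Fintype ι] {f : ι → ℝ → ℝ}
    (hf : ∀ i, Integrable (f i)) (h0 : ∀ i x, 0 ≤ f i x) :
    Measure.pi (fun i => volume.withDensity fun x => ENNReal.ofReal (f i x)) =
      volume.withDensity fun x : ι → ℝ => ENNReal.ofReal (∏ i, f i (x i)) := by
  have hfin (i) : IsFiniteMeasure (volume.withDensity fun x => ENNReal.ofReal (f i x)) :=
    isFiniteMeasure_withDensity_ofReal (hf i).2
  refine Measure.pi_eq fun s hs => ?_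
  have hind (i) : Integrable ((s i).indicator (f i)) := (hf i).indicator (hs i)
  have hind0 (i x) : 0 ≤ (s i).indicator (f i) x := Set.indicator_nonneg (fun x _ => h0 i x) x
  have hprod (x : ι → ℝ) : (Set.univ.pi s).indicator (fun x => ∏ i, f i (x i)) x
      = ∏ i, (s i).indicator (f i) (x i) := by
    by_cases hx : x ∈ Set.univ.pi s
    · rw [Set.indicator_of_mem hx]
      exact Finset.prod_congr rfl fun i _ => (Set.indicator_of_mem (hx i trivial) _).symm
    · rw [Set.indicator_of_notMem hx]
      simp only [Set.mem_pi, Set.mem_univ, true_imp_iff, not_forall] at hx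
      obtain ⟨i, hi⟩ := hx
      exact (Finset.prod_eq_zero (Finset.mem_univ i) (Set.indicator_of_notMem hi _)).symm
  rw [withDensity_apply _ (MeasurableSet.univ_pi hs),
    ← lintegral_indicator (MeasurableSet.univ_pi hs)]
  have h1 : ∀ x : ι → ℝ, (Set.univ.pi s).indicator
      (fun x => ENNReal.ofReal (∏ i, f i (x i))) x
      = ENNReal.ofReal (∏ i, (s i).indicator (f i) (x i)) := fun x => by
    rw [← hprod]
    by_cases hx : x ∈ Set.univ.pi s
    · simp only [Set.indicator_of_mem hx]
    · simp only [Set.indicator_of_notMem hx, ENNReal.ofReal_zero]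
  simp only [h1]
  rw [volume_pi, ← ofReal_integral_eq_lintegral_ofReal (Integrable.fintype_prod hind)
    (.of_forall fun x => Finset.prod_nonneg fun i _ => hind0 i _),
    integral_fintype_prod_eq_prod, ENNReal.ofReal_prod_of_nonneg
      fun i _ => integral_nonneg (hind0 i)]
  refine Finset.prod_congr rfl fun i _ => ?_
  rw [withDensity_apply _ (hs i), integral_indicator (hs i),
    ofReal_integral_eq_lintegral_ofReal (hf i).integrableOn (.of_forall (h0 i))]

/-- Change of variables for densities: if `T ∘ X` has density `f` for an invertible linear map `T`,
then `X` has density `|det T| f ∘ T`. -/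
theorem withDensity_of_map_linearMap {E : Type*} [NormedAddCommGroup E] [NormedSpace ℝ E]
    [FiniteDimensional ℝ E] [MeasurableSpace E] [BorelSpace E] {ν : Measure E} [ν.IsAddHaarMeasure]
    (T : E →ₗ[ℝ] E) (hT : LinearMap.det T ≠ 0) {μ : Measure E} {f : E → ENNReal}
    (hμ : μ.map T = ν.withDensity f) :
    μ = ν.withDensity fun x => ENNReal.ofReal |LinearMap.det T| * f (T x) := by
  let e := LinearEquiv.ofIsUnitDet (f := T) (v := Module.finBasis ℝ E) (v' := Module.finBasis ℝ E)
    (by rw [LinearMap.det_toMatrix]; exact hT.isUnit)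
  have he : ∀ x, e x = T x := fun x => rfl
  have hinj : Function.Injective T := e.injective
  have hTc : Continuous T := T.continuous_of_finiteDimensional
  ext s hs
  have himg : MeasurableSet (T '' s) :=
    hTc.measurable.measurableEmbedding hinj |>.measurableSet_image.2 hs
  rw [withDensity_apply _ hs]
  have h1 := lintegral_image_eq_lintegral_abs_det_fderiv_mul ν hs
    (f := T) (f' := fun _ => T.toContinuousLinearMap)
    (fun x _ => T.toContinuousLinearMap.hasFDerivAt.hasFDerivWithinAt) hinj.injOn f
  have h2 : (T.toContinuousLinearMap).det = LinearMap.det T := rfl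
  simp only [h2] at h1
  rw [← h1, ← withDensity_apply _ himg, ← hμ, Measure.map_apply hTc.measurable himg,
    Set.preimage_image_eq _ hinj]

/-! ### End sum and increments -/

/-- The linear map `x ↦ (x₀ + xₙ, x₁ - x₀, …, xₙ - xₙ₋₁)`. -/
def endSumIncrements (n : ℕ) : (Fin (n + 1) → ℝ) →ₗ[ℝ] (Fin (n + 1) → ℝ) :=
  let π (j : Fin (n + 1)) : (Fin (n + 1) → ℝ) →ₗ[ℝ] ℝ := LinearMap.proj j
  LinearMap.pi (Fin.cons (π 0 + π (Fin.last n)) fun i : Fin n => π i.succ - π i.castSucc)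

@[simp]
theorem endSumIncrements_zero (n : ℕ) (x : Fin (n + 1) → ℝ) :
    endSumIncrements n x 0 = x 0 + x (Fin.last n) := rfl

@[simp]
theorem endSumIncrements_succ (n : ℕ) (x : Fin (n + 1) → ℝ) (i : Fin n) :
    endSumIncrements n x i.succ = x i.succ - x i.castSucc := rfl

theorem sum_fin_succ_sub_castSucc {n : ℕ} (x : Fin (n + 1) → ℝ) :
    ∑ i : Fin n, (x i.succ - x i.castSucc) = x (Fin.last n) - x 0 := by
  induction n with
  | zero => simp
  | succ n ih =>
    rw [Fin.sum_univ_castSucc]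
    have := ih fun i => x i.castSucc
    simp only [Fin.succ_castSucc, Fin.succ_last, Fin.castSucc_zero] at this ⊢
    rw [this]
    ring

/-- The map factors as a unipotent map `x ↦ (x₀, x₁ - x₀, …)` followed by a triangular map which
doubles the first coordinate. -/
theorem det_endSumIncrements (n : ℕ) : LinearMap.det (endSumIncrements n) = 2 := by
  let π (j : Fin (n + 1)) : (Fin (n + 1) → ℝ) →ₗ[ℝ] ℝ := LinearMap.proj j
  let A : (Fin (n + 1) → ℝ) →ₗ[ℝ] (Fin (n + 1) → ℝ) :=
    LinearMap.pi (Fin.cons (π 0) fun i : Fin n => π i.succ - π i.castSucc)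
  let B : (Fin (n + 1) → ℝ) →ₗ[ℝ] (Fin (n + 1) → ℝ) :=
    LinearMap.pi (Fin.cons ((2 : ℝ) • π 0 + ∑ i : Fin n, π i.succ) fun i : Fin n => π i.succ)
  have hA0 (x) : A x 0 = x 0 := rfl
  have hAs (x) (i : Fin n) : A x i.succ = x i.succ - x i.castSucc := rfl
  have hB0 (x) : B x 0 = 2 * x 0 + ∑ i : Fin n, x i.succ := by
    simp [B, π]
  have hBs (x) (i : Fin n) : B x i.succ = x i.succ := rfl
  have hAB : endSumIncrements n = B ∘ₗ A := by
    refine LinearMap.ext fun x => funext fun j => ?_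
    rw [LinearMap.comp_apply]
    refine Fin.cases ?_ (fun i => ?_) j
    · rw [hB0, hA0]
      simp only [hAs, sum_fin_succ_sub_castSucc, endSumIncrements_zero]
      ring
    · rw [hBs, hAs, endSumIncrements_succ]
  have hdA : LinearMap.det A = 1 := by
    rw [← LinearMap.det_toMatrix', Matrix.det_of_isLowerTriangular]
    · refine Finset.prod_eq_one fun j _ => ?_
      rw [LinearMap.toMatrix'_apply]
      refine Fin.cases ?_ (fun i => ?_) j
      · simp [hA0]
      · simp [hAs, i.castSucc_lt_succ.ne]
    · intro i j hij
      replace hij : i < j := hij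
      rw [LinearMap.toMatrix'_apply]
      revert hij
      refine Fin.cases (fun hij => ?_) (fun i hij => ?_) i
      · simp [hA0, hij.ne]
      · simp [hAs, hij.ne, (i.castSucc_lt_succ.trans hij).ne]
  have hdB : LinearMap.det B = 2 := by
    rw [← LinearMap.det_toMatrix', Matrix.det_of_isUpperTriangular]
    · rw [Fin.prod_univ_succ]
      simp [LinearMap.toMatrix'_apply, hB0, hBs]
    · intro i j hij
      replace hij : j < i := hij
      rw [LinearMap.toMatrix'_apply]
      revert hij
      refine Fin.cases (fun hij => ?_) (fun i hij => ?_) i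
      · exact absurd hij (Fin.not_lt_zero _)
      · simp [hBs, hij.ne']
  rw [hAB, LinearMap.det_comp, hdA, hdB, mul_one]

/-! ### Bridges of a Slepian process -/

theorem isGaussianProcess_of_linearCombination {Ω S T : Type*} [MeasurableSpace Ω] {P : Measure Ω}
    {X : T → Ω → ℝ} (hX : IsGaussianProcess X P) {Z : S → Ω → ℝ}
    (h : ∀ s, ∃ c : T →₀ ℝ, ∀ ω, Z s ω = Finsupp.linearCombination ℝ (fun t => X t ω) c) :
    IsGaussianProcess Z P := by
  refine hX.of_isGaussianProcess fun s => ?_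
  obtain ⟨c, hc⟩ := h s
  refine ⟨c.support, ∑ i : c.support, c i • ContinuousLinearMap.proj i, fun ω => ?_⟩
  rw [hc, Finsupp.linearCombination_apply, Finsupp.sum, ← Finset.sum_coe_sort]
  simp

namespace IsSlepianProcess

variable {Ω : Type*} [MeasurableSpace Ω] {P : Measure Ω} {q d : ℝ}
  {W : Set.Icc q d → Ω → ℝ}

theorem memLp_two (hW : IsSlepianProcess q d W P) (s : Set.Icc q d) : MemLp (W s) 2 P :=
  (hW.isGaussianProcess.hasGaussianLaw_eval s).memLp_two

/-- On an interval of length at most `q` the covariance is `1 - |s - t| / q`: the positive part in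
its definition plays no role. -/
theorem covariance_eq_one_sub (hW : IsSlepianProcess q d W P) (hq : 0 < q) (hd : d ≤ 2 * q)
    {s t : Set.Icc q d} (h : s ≤ t) : cov[W s, W t; P] = 1 - ((t : ℝ) - s) / q := by
  rw [hW.covariance_eq s t h, max_eq_left]
  rw [sub_nonneg, div_le_one hq]
  linarith [s.2.1, t.2.2]

/-- The residual at time `s` of the process after subtraction of the chord joining its values at
times `a` and `b`. -/
noncomputable def bridge (W : Set.Icc q d → Ω → ℝ) (a b s : Set.Icc q d) (ω : Ω) : ℝ :=
  W s ω - (((b : ℝ) - s) / (b - a) * W a ω + ((s : ℝ) - a) / (b - a) * W b ω)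

theorem measurable_bridge (hW : IsSlepianProcess q d W P) (a b s : Set.Icc q d) :
    Measurable (bridge W a b s) :=
  (hW.measurable s).sub (((hW.measurable a).const_mul _).add ((hW.measurable b).const_mul _))

theorem memLp_two_bridge (hW : IsSlepianProcess q d W P) (a b s : Set.Icc q d) :
    MemLp (bridge W a b s) 2 P :=
  (hW.memLp_two s).sub (((hW.memLp_two a).const_mul _).add ((hW.memLp_two b).const_mul _))

variable [IsProbabilityMeasure P]

theorem covariance_bridge_left (hW : IsSlepianProcess q d W P) (a b s : Set.Icc q d)
    {Z : Ω → ℝ} (hZ : MemLp Z 2 P) :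
    cov[bridge W a b s, Z; P] = cov[W s, Z; P]
      - (((b : ℝ) - s) / (b - a) * cov[W a, Z; P] + ((s : ℝ) - a) / (b - a) * cov[W b, Z; P]) := by
  have ha := (hW.memLp_two a).const_mul (((b : ℝ) - s) / (b - a))
  have hb := (hW.memLp_two b).const_mul (((s : ℝ) - a) / (b - a))
  have h : bridge W a b s = W s - ((fun ω => ((b : ℝ) - s) / (b - a) * W a ω)
      + fun ω => ((s : ℝ) - a) / (b - a) * W b ω) := rfl
  rw [h, covariance_sub_left (hW.memLp_two s) (ha.add hb) hZ, covariance_add_left ha hb hZ,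
    covariance_const_mul_left, covariance_const_mul_left]

/-- The bridge over `[a, b]` is uncorrelated with the values of the process outside `(a, b)`, since
the covariance function is affine on `[a, b]` when its other argument lies outside `(a, b)`. -/
theorem covariance_bridge_eq_zero (hW : IsSlepianProcess q d W P) (hq : 0 < q) (hd : d ≤ 2 * q)
    {a b s v : Set.Icc q d} (has : a < s) (hsb : s < b) (hv : v ≤ a ∨ b ≤ v) :
    cov[bridge W a b s, W v; P] = 0 := by
  have hba : (b : ℝ) - a ≠ 0 := by
    have : (a : ℝ) < b := has.trans hsb
    linarith
  rw [hW.covariance_bridge_left _ _ _ (hW.memLp_two v)]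
  rcases hv with hv | hv
  · rw [covariance_comm (W s), covariance_comm (W a), covariance_comm (W b),
      hW.covariance_eq_one_sub hq hd hv, hW.covariance_eq_one_sub hq hd (hv.trans has.le),
      hW.covariance_eq_one_sub hq hd (hv.trans (has.trans hsb).le)]
    field_simp
    ring
  · rw [hW.covariance_eq_one_sub hq hd hv, hW.covariance_eq_one_sub hq hd (hsb.le.trans hv),
      hW.covariance_eq_one_sub hq hd ((has.trans hsb).le.trans hv)]
    field_simp
    ring

theorem covariance_bridge_bridge_eq_zero (hW : IsSlepianProcess q d W P) (hq : 0 < q)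
    (hd : d ≤ 2 * q) {a b s a' b' s' : Set.Icc q d} (has : a < s) (hsb : s < b) (has' : a' < s')
    (hsb' : s' < b') (h : b ≤ a') : cov[bridge W a b s, bridge W a' b' s'; P] = 0 := by
  have h1 := has'.trans hsb'
  rw [covariance_comm, hW.covariance_bridge_left _ _ _ (hW.memLp_two_bridge _ _ _),
    covariance_comm _ (bridge W a b s), covariance_comm _ (bridge W a b s),
    covariance_comm _ (bridge W a b s),
    hW.covariance_bridge_eq_zero hq hd has hsb (.inr (h.trans has'.le)),
    hW.covariance_bridge_eq_zero hq hd has hsb (.inr h),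
    hW.covariance_bridge_eq_zero hq hd has hsb (.inr (h.trans h1.le))]
  ring

/-! ### Independence of the skeleton and the bridges -/

variable {n : ℕ} {t : Fin (n + 1) → Set.Icc q d}

theorem le_castSucc_or_succ_le (ht : StrictMono t) (i : Fin n) (j : Fin (n + 1)) :
    t j ≤ t i.castSucc ∨ t i.succ ≤ t j := by
  rcases le_or_gt j i.castSucc with h | h
  · exact .inl (ht.monotone h)
  · exact .inr (ht.monotone (Fin.castSucc_lt_iff_succ_le.1 h))

theorem exists_linearCombination_bridge {Ω : Type*} (W : Set.Icc q d → Ω → ℝ) (a b s : Set.Icc q d) :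
    ∃ c : Set.Icc q d →₀ ℝ, ∀ ω,
      bridge W a b s ω = Finsupp.linearCombination ℝ (fun r => W r ω) c :=
  ⟨Finsupp.single s 1 - (Finsupp.single a (((b : ℝ) - s) / (b - a))
    + Finsupp.single b (((s : ℝ) - a) / (b - a))), fun ω => by simp [bridge]⟩

/-- The values at the times `t i` are independent of the family of bridges between these times. -/
theorem indepFun_skeleton_bridges (hW : IsSlepianProcess q d W P) (hq : 0 < q) (hd : d ≤ 2 * q)
    (ht : StrictMono t) :
    IndepFun (fun ω j => W (t j) ω)
      (fun ω (i : Fin n) (s : Set.Ioo (t i.castSucc) (t i.succ)) =>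
        bridge W (t i.castSucc) (t i.succ) s ω) P := by
  have h := IsGaussianProcess.indepFun_of_covariance_eq_zero (P := P)
    (X := fun j ω => W (t j) ω)
    (Y := fun (z : Σ i : Fin n, Set.Ioo (t i.castSucc) (t i.succ)) ω =>
      bridge W (t z.1.castSucc) (t z.1.succ) z.2 ω)
    (isGaussianProcess_of_linearCombination hW.isGaussianProcess ?_)
    (fun j => (hW.measurable _).aemeasurable)
    (fun z => (hW.measurable_bridge _ _ _).aemeasurable) ?_
  · exact h.comp measurable_id (ψ := fun r i s => r ⟨i, s⟩)
      (measurable_pi_lambda _ fun i => measurable_pi_lambda _ fun s => measurable_pi_apply _)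
  · rintro (j | z)
    · exact ⟨Finsupp.single (t j) 1, fun ω => by simp⟩
    · exact exists_linearCombination_bridge W _ _ _
  · intro j z
    rw [covariance_comm]
    exact hW.covariance_bridge_eq_zero hq hd z.2.2.1 z.2.2.2 (le_castSucc_or_succ_le ht _ _)

theorem iIndepFun_bridges (hW : IsSlepianProcess q d W P) (hq : 0 < q) (hd : d ≤ 2 * q)
    (ht : StrictMono t) :
    iIndepFun (fun (i : Fin n) ω (s : Set.Ioo (t i.castSucc) (t i.succ)) =>
        bridge W (t i.castSucc) (t i.succ) s ω) P := by
  refine IsGaussianProcess.iIndepFun_of_covariance_eq_zero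
    (X := fun (i : Fin n) (s : Set.Ioo (t i.castSucc) (t i.succ)) ω =>
      bridge W (t i.castSucc) (t i.succ) s ω)
    (isGaussianProcess_of_linearCombination hW.isGaussianProcess
      fun z => exists_linearCombination_bridge W _ _ _)
    (fun i s => (hW.measurable_bridge _ _ _).aemeasurable) fun i j hij s r => ?_
  rcases lt_or_gt_of_ne hij with h | h
  · exact hW.covariance_bridge_bridge_eq_zero hq hd s.2.1 s.2.2 r.2.1 r.2.2
      (ht.monotone (Fin.succ_le_castSucc_iff.2 h))
  · rw [covariance_comm]
    exact hW.covariance_bridge_bridge_eq_zero hq hd r.2.1 r.2.2 s.2.1 s.2.2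
      (ht.monotone (Fin.succ_le_castSucc_iff.2 h))

/-! ### The density of the skeleton -/

/-- The variances of `W_{t₀} + W_{tₙ}` and of the increments `W_{tᵢ₊₁} - W_{tᵢ}`. -/
noncomputable def endSumIncrementsVar (q d : ℝ) {n : ℕ} (t : Fin (n + 1) → ℝ) : Fin (n + 1) → ℝ :=
  Fin.cons (2 * (3 * q - d) / q) fun i => 2 * (t i.succ - t i.castSucc) / q

/-- The end sum `W_{t₀} + W_{tₙ}` and the increments are pairwise uncorrelated. -/
theorem covariance_endSumIncrements (hW : IsSlepianProcess q d W P) (hq : 0 < q) (hd : d ≤ 2 * q)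
    (ht : StrictMono t) (ht0 : (t 0 : ℝ) = q) (htn : (t (Fin.last n) : ℝ) = d)
    (i j : Fin (n + 1)) :
    cov[fun ω => endSumIncrements n (fun k => W (t k) ω) i,
      fun ω => endSumIncrements n (fun k => W (t k) ω) j; P]
      = if i = j then endSumIncrementsVar q d (fun k => (t k : ℝ)) i else 0 := by
  have hL := hW.memLp_two
  have hc {s r : Set.Icc q d} (h : s ≤ r) : cov[W s, W r; P] = 1 - ((r : ℝ) - s) / q :=
    hW.covariance_eq_one_sub hq hd h
  have hc' {s r : Set.Icc q d} (h : s ≤ r) : cov[W r, W s; P] = 1 - ((r : ℝ) - s) / q := by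
    rw [covariance_comm, hc h]
  have hlast (k) : t k ≤ t (Fin.last n) := ht.monotone (Fin.le_last k)
  have hzero (k) : t 0 ≤ t k := ht.monotone (Fin.zero_le k)
  have hstep (k : Fin n) : t k.castSucc ≤ t k.succ := ht.monotone k.castSucc_lt_succ.le
  -- the end sum against an increment
  have hSD (k : Fin n) : cov[fun ω => W (t 0) ω + W (t (Fin.last n)) ω,
      fun ω => W (t k.succ) ω - W (t k.castSucc) ω; P] = 0 := by
    change cov[W (t 0) + W (t (Fin.last n)), W (t k.succ) - W (t k.castSucc); P] = 0
    rw [covariance_add_left (hL _) (hL _) ((hL _).sub (hL _)),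
      covariance_sub_right (hL _) (hL _) (hL _), covariance_sub_right (hL _) (hL _) (hL _),
      hc (hzero _), hc (hzero _), hc' (hlast _), hc' (hlast _)]
    ring
  -- two increments over disjoint intervals
  have hDD {k l : Fin n} (hkl : k < l) : cov[fun ω => W (t k.succ) ω - W (t k.castSucc) ω,
      fun ω => W (t l.succ) ω - W (t l.castSucc) ω; P] = 0 := by
    have h1 : t k.succ ≤ t l.castSucc := ht.monotone (Fin.succ_le_castSucc_iff.2 hkl)
    change cov[W (t k.succ) - W (t k.castSucc), W (t l.succ) - W (t l.castSucc); P] = 0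
    rw [covariance_sub_sub (hL _) (hL _) (hL _) (hL _), hc h1, hc (h1.trans (hstep l)),
      hc ((hstep k).trans h1), hc (((hstep k).trans h1).trans (hstep l))]
    ring
  refine Fin.cases ?_ (fun k => ?_) i <;> refine Fin.cases ?_ (fun l => ?_) j
  · simp only [endSumIncrements_zero, if_true, endSumIncrementsVar, Fin.cons_zero]
    change cov[W (t 0) + W (t (Fin.last n)), W (t 0) + W (t (Fin.last n)); P] = _
    rw [covariance_add_left (hL _) (hL _) ((hL _).add (hL _)),
      covariance_add_right (hL _) (hL _) (hL _), covariance_add_right (hL _) (hL _) (hL _),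
      hc le_rfl, hc (hlast _), hc' (hlast _), hc le_rfl, ht0, htn]
    field_simp
    ring
  · simp only [endSumIncrements_zero, endSumIncrements_succ, (Fin.succ_ne_zero l).symm, if_false]
    exact hSD l
  · simp only [endSumIncrements_zero, endSumIncrements_succ, Fin.succ_ne_zero k, if_false]
    rw [covariance_comm]
    exact hSD k
  · simp only [endSumIncrements_succ, Fin.succ_inj]
    split_ifs with hkl
    · subst hkl
      simp only [endSumIncrementsVar, Fin.cons_succ]
      change cov[W (t k.succ) - W (t k.castSucc), W (t k.succ) - W (t k.castSucc); P] = _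
      rw [covariance_sub_sub (hL _) (hL _) (hL _) (hL _), hc le_rfl, hc le_rfl, hc (hstep k),
        hc' (hstep k)]
      field_simp
      ring
    · rcases lt_or_gt_of_ne hkl with h | h
      · exact hDD h
      · rw [covariance_comm]
        exact hDD h

/-- The joint density of the values at the times `t i`: the end sum and the increments are
independent Gaussians, and the factor `2` is the determinant of the change of variables. -/
noncomputable def skeletonDensity (q d : ℝ) {n : ℕ} (t : Fin (n + 1) → ℝ) (x : Fin (n + 1) → ℝ) : ℝ :=
  2 * ∏ i, gaussianPDFReal 0 (endSumIncrementsVar q d t i).toNNReal (endSumIncrements n x i)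

theorem endSumIncrementsVar_pos (hq : 0 < q) (hd : d ≤ 2 * q) (ht : StrictMono t)
    (i : Fin (n + 1)) : 0 < endSumIncrementsVar q d (fun k => (t k : ℝ)) i := by
  refine Fin.cases ?_ (fun k => ?_) i
  · simp only [endSumIncrementsVar, Fin.cons_zero]
    have : 0 < 3 * q - d := by linarith
    positivity
  · simp only [endSumIncrementsVar, Fin.cons_succ]
    have : (t k.castSucc : ℝ) < t k.succ := ht k.castSucc_lt_succ
    have : 0 < (t k.succ : ℝ) - t k.castSucc := by linarith
    positivity

theorem map_skeleton (hW : IsSlepianProcess q d W P) (hq : 0 < q) (hd : d ≤ 2 * q)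
    (ht : StrictMono t) (ht0 : (t 0 : ℝ) = q) (htn : (t (Fin.last n) : ℝ) = d) :
    P.map (fun ω j => W (t j) ω) = volume.withDensity fun x =>
      ENNReal.ofReal (skeletonDensity q d (fun k => (t k : ℝ)) x) := by
  set v := endSumIncrementsVar q d (fun k => (t k : ℝ)) with hv_def
  have hv (i) : 0 < v i := endSumIncrementsVar_pos hq hd ht i
  have hX : Measurable fun ω j => W (t j) ω := measurable_pi_lambda _ fun j => hW.measurable _
  have hTm : Measurable (endSumIncrements n) :=
    (endSumIncrements n).continuous_of_finiteDimensional.measurable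
  set Y : Fin (n + 1) → Ω → ℝ := fun i ω => endSumIncrements n (fun k => W (t k) ω) i with hY_def
  have hYm (i) : Measurable (Y i) := (measurable_pi_apply i).comp (hTm.comp hX)
  have hcov (i j) : cov[Y i, Y j; P] = if i = j then v i else 0 :=
    hW.covariance_endSumIncrements hq hd ht ht0 htn i j
  have hlin (i) : ∃ c : Set.Icc q d →₀ ℝ, ∀ ω,
      Y i ω = Finsupp.linearCombination ℝ (fun r => W r ω) c := by
    refine Fin.cases ?_ (fun k => ?_) i
    · exact ⟨Finsupp.single (t 0) 1 + Finsupp.single (t (Fin.last n)) 1, fun ω => by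
        simp [hY_def]⟩
    · exact ⟨Finsupp.single (t k.succ) 1 - Finsupp.single (t k.castSucc) 1, fun ω => by
        simp [hY_def]⟩
  have hind : iIndepFun Y P := by
    have h := IsGaussianProcess.iIndepFun_of_covariance_eq_zero (P := P)
      (X := fun (i : Fin (n + 1)) (_ : Unit) => Y i)
      (isGaussianProcess_of_linearCombination hW.isGaussianProcess fun z => hlin z.1)
      (fun i _ => (hYm i).aemeasurable) (fun i j hij _ _ => by rw [hcov, if_neg hij])
    exact h.comp (fun _ r => r ()) fun _ => measurable_pi_apply _
  have hmean (i) : ∫ ω, Y i ω ∂P = 0 := by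
    have hint (r) : Integrable (W r) P := (hW.memLp_two r).integrable (by norm_num)
    refine Fin.cases ?_ (fun k => ?_) i
    · simp only [hY_def, endSumIncrements_zero]
      rw [integral_add (hint _) (hint _), hW.centered, hW.centered, add_zero]
    · simp only [hY_def, endSumIncrements_succ]
      rw [integral_sub (hint _) (hint _), hW.centered, hW.centered, sub_zero]
  have hlaw (i) : P.map (Y i) = volume.withDensity fun x =>
      ENNReal.ofReal (gaussianPDFReal 0 (v i).toNNReal x) := by
    rw [((isGaussianProcess_of_linearCombination hW.isGaussianProcess hlin).hasGaussianLaw_eval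
      i).map_eq_gaussianReal, hmean, ← covariance_self (hYm i).aemeasurable, hcov, if_pos rfl,
      gaussianReal_of_var_ne_zero _ (Real.toNNReal_pos.2 (hv i)).ne']
    rfl
  have hmap : (P.map fun ω j => W (t j) ω).map (endSumIncrements n) =
      volume.withDensity fun x =>
        ENNReal.ofReal (∏ i, gaussianPDFReal 0 (v i).toNNReal (x i)) := by
    rw [Measure.map_map hTm hX]
    have := hind.map_fun_eq_pi_map fun i => (hYm i).aemeasurable
    simp only [hlaw] at this
    rw [pi_withDensity_ofReal (fun i => integrable_gaussianPDFReal _ _)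
      (fun i => gaussianPDFReal_nonneg _ _)] at this
    exact this
  rw [withDensity_of_map_linearMap (endSumIncrements n)
    (by rw [det_endSumIncrements]; norm_num) hmap]
  congr 1
  ext x
  rw [det_endSumIncrements, skeletonDensity, ENNReal.ofReal_mul zero_le_two, abs_two]

end IsSlepianProcess

/-! ### Telescoping the integrand -/

theorem prod_fin_succ_div_castSucc {n : ℕ} (u : Fin (n + 1) → ℝ) (hu : ∀ i, u i ≠ 0) :
    ∏ i : Fin n, (u i.succ / u i.castSucc) = u (Fin.last n) / u 0 := by
  induction n with
  | zero => simp [hu 0]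
  | succ n ih =>
    rw [Fin.prod_univ_castSucc]
    have := ih (fun i => u i.castSucc) fun i => hu _
    simp only [Fin.succ_castSucc, Fin.succ_last, Fin.castSucc_zero] at this ⊢
    rw [this, mul_comm, div_mul_div_cancel₀ (hu _)]

theorem slepianIntegrand_eq_prod_mul (q d : ℝ) (n : ℕ) (t : Fin (n + 1) → ℝ)
    (p : Fin n → ℝ × ℝ → ℝ) (x : Fin (n + 1) → ℝ) :
    slepianIntegrand q d n t p x =
      (∏ i : Fin n, p i (x i.castSucc, x i.succ)) * slepianIntegrand q d n t (fun _ _ => 1) x := by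
  simp only [slepianIntegrand, Finset.prod_const_one, mul_one]
  ring

section Density

variable {q d : ℝ} {n : ℕ} {t : Fin (n + 1) → ℝ}

/-- The exponent of the integrand telescopes to that of the density of the end sum and of the
increments. -/
theorem slepianIntegrand_one (ht0 : t 0 = q) (htn : t (Fin.last n) = d) (x : Fin (n + 1) → ℝ) :
    slepianIntegrand q d n t (fun _ _ => 1) x =
      Real.exp (-(q / 4) * ((x 0 + x (Fin.last n)) ^ 2 / (3 * q - d)
        + ∑ i : Fin n, (x i.succ - x i.castSucc) ^ 2 / (t i.succ - t i.castSucc))) := by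
  simp only [slepianIntegrand, Finset.prod_const_one, mul_one]
  rw [← Real.exp_sum, ← Real.exp_add, ← Finset.mul_sum, ← mul_add]
  congr 2
  -- The term with `i = 0` vanishes (its first fraction is `0 / 0 = 0`), so that it may be included
  -- in the sum.
  have hfilter : ∑ i ∈ Finset.univ.filter (fun i : Fin n => 0 < (i : ℕ)),
      ((x i.castSucc - x 0) ^ 2 / (t i.castSucc - q)
        + (x i.succ - x i.castSucc) ^ 2 / (t i.succ - t i.castSucc)
        - (x i.succ - x 0) ^ 2 / (t i.succ - q))
      = ∑ i : Fin n, ((x i.castSucc - x 0) ^ 2 / (t i.castSucc - q)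
        + (x i.succ - x i.castSucc) ^ 2 / (t i.succ - t i.castSucc)
        - (x i.succ - x 0) ^ 2 / (t i.succ - q)) := by
    refine Finset.sum_subset (Finset.filter_subset _ _) fun i _ hi => ?_
    have h0 : (i : ℕ) = 0 := by simpa using hi
    have h1 : i.castSucc = 0 := Fin.ext h0
    rw [h1, ht0]
    simp
  have htel := sum_fin_succ_sub_castSucc fun j => (x j - x 0) ^ 2 / (t j - q)
  have hsplit : ∑ i : Fin n, ((x i.castSucc - x 0) ^ 2 / (t i.castSucc - q)
        + (x i.succ - x i.castSucc) ^ 2 / (t i.succ - t i.castSucc)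
        - (x i.succ - x 0) ^ 2 / (t i.succ - q))
      = ∑ i : Fin n, (x i.succ - x i.castSucc) ^ 2 / (t i.succ - t i.castSucc)
        - ∑ i : Fin n, ((x i.succ - x 0) ^ 2 / (t i.succ - q)
          - (x i.castSucc - x 0) ^ 2 / (t i.castSucc - q)) := by
    rw [← Finset.sum_sub_distrib]
    exact Finset.sum_congr rfl fun i _ => by ring
  rw [hfilter, hsplit, htel, htn]
  simp only [sub_self, ne_eq, OfNat.ofNat_ne_zero, not_false_eq_true, zero_pow, zero_div]
  ring

/-- The normalising constant of the statement, in terms of the lengths of the time steps. -/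
theorem slepianConst_mul_prod (hq : 0 < q) (hd : d ≤ 2 * q) (hqd : q < d) (ht : StrictMono t)
    (ht0 : t 0 = q) (htn : t (Fin.last n) = d) :
    slepianConst q d n * ∏ i ∈ Finset.univ.filter (fun i : Fin n => 0 < (i : ℕ)),
        √(t i.succ - q) / √((t i.succ - t i.castSucc) * (t i.castSucc - q))
      = 2 * (√q / (2 * √Real.pi)) ^ (n + 1) *
        ((√(3 * q - d))⁻¹ * ∏ i : Fin n, (√(t i.succ - t i.castSucc))⁻¹) := by
  obtain ⟨m, rfl⟩ : ∃ m, n = m + 1 := by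
    -- `n = 0` is excluded by `t 0 = q < d = t n`.
    refine Nat.exists_eq_succ_of_ne_zero ?_
    rintro rfl
    exact hqd.ne (ht0.symm.trans htn)
  have hrpow {a : ℝ} (ha : 0 ≤ a) : a ^ ((((m + 1 : ℕ) : ℝ) + 1) / 2) = √a ^ (m + 1 + 1) := by
    rw [Real.sqrt_eq_rpow, ← Real.rpow_natCast, ← Real.rpow_mul ha]
    congr 1
    push_cast
    ring
  have hstep (i : Fin (m + 1)) : 0 < t i.succ - t i.castSucc := sub_pos.2 (ht i.castSucc_lt_succ)
  have hpos (j : Fin (m + 1)) : 0 < t j.succ - q := sub_pos.2 (ht0 ▸ ht (Fin.succ_pos j))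
  have hprod : ∏ i ∈ Finset.univ.filter (fun i : Fin (m + 1) => 0 < (i : ℕ)),
        √(t i.succ - q) / √((t i.succ - t i.castSucc) * (t i.castSucc - q))
      = √(d - q) * ∏ i : Fin (m + 1), (√(t i.succ - t i.castSucc))⁻¹ := by
    rw [Finset.prod_filter, Fin.prod_univ_succ, Fin.prod_univ_succ]
    simp only [Fin.val_zero, lt_self_iff_false, if_false, one_mul, Fin.val_succ, Nat.succ_pos,
      if_true]
    have h1 (j : Fin m) : √(t j.succ.succ - q)
          / √((t j.succ.succ - t j.succ.castSucc) * (t j.succ.castSucc - q))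
        = √(t j.succ.succ - q) / √(t j.castSucc.succ - q)
          * (√(t j.succ.succ - t j.succ.castSucc))⁻¹ := by
      rw [Real.sqrt_mul (hstep _).le, ← Fin.succ_castSucc, div_eq_mul_inv, div_eq_mul_inv, mul_inv]
      ring
    simp only [h1]
    rw [Finset.prod_mul_distrib, prod_fin_succ_div_castSucc (fun j => √(t j.succ - q))
      fun j => (Real.sqrt_pos.2 (hpos j)).ne', Fin.succ_last, htn, Fin.castSucc_zero, ht0]
    ring
  have hdq : √(d - q) ≠ 0 := (Real.sqrt_pos.2 (sub_pos.2 hqd)).ne'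
  have h3 : √(3 * q - d) ≠ 0 := (Real.sqrt_pos.2 (by linarith)).ne'
  rw [hprod, slepianConst, hrpow hq.le, hrpow Real.pi_pos.le,
    Real.sqrt_mul (by linarith : 0 ≤ 3 * q - d)]
  generalize ∏ i : Fin (m + 1), (√(t i.succ - t i.castSucc))⁻¹ = Q
  rw [div_pow, mul_pow]
  field_simp
  ring

theorem skeletonDensity_eq (hq : 0 < q) (hd : d ≤ 2 * q) (hqd : q < d) (ht : StrictMono t)
    (ht0 : t 0 = q) (htn : t (Fin.last n) = d) (x : Fin (n + 1) → ℝ) :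
    IsSlepianProcess.skeletonDensity q d t x =
      (slepianConst q d n * ∏ i ∈ Finset.univ.filter (fun i : Fin n => 0 < (i : ℕ)),
        √(t i.succ - q) / √((t i.succ - t i.castSucc) * (t i.castSucc - q)))
      * slepianIntegrand q d n t (fun _ _ => 1) x := by
  have hpdf {w : ℝ} (hw : 0 < w) (y : ℝ) : gaussianPDFReal 0 (2 * w / q).toNNReal y =
      √q / (2 * √Real.pi) * (√w)⁻¹ * Real.exp (-(q / 4) * (y ^ 2 / w)) := by
    rw [gaussianPDFReal, Real.coe_toNNReal _ (by positivity)]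
    have h1 : 2 * Real.pi * (2 * w / q) = 2 ^ 2 * (Real.pi * w / q) := by ring
    have h2 : -(y - 0) ^ 2 / (2 * (2 * w / q)) = -(q / 4) * (y ^ 2 / w) := by
      field_simp
      ring
    rw [h1, h2, Real.sqrt_mul (by positivity), Real.sqrt_sq (by norm_num),
      Real.sqrt_div (by positivity), Real.sqrt_mul Real.pi_pos.le]
    congr 1
    have : √w ≠ 0 := (Real.sqrt_pos.2 hw).ne'
    have : √q ≠ 0 := (Real.sqrt_pos.2 hq).ne'
    field_simp
  have hstep (i : Fin n) : 0 < t i.succ - t i.castSucc := sub_pos.2 (ht i.castSucc_lt_succ)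
  rw [slepianConst_mul_prod hq hd hqd ht ht0 htn, slepianIntegrand_one ht0 htn,
    IsSlepianProcess.skeletonDensity, Fin.prod_univ_succ]
  simp only [IsSlepianProcess.endSumIncrementsVar, Fin.cons_zero, Fin.cons_succ,
    endSumIncrements_zero, endSumIncrements_succ]
  rw [hpdf (by linarith), Finset.prod_congr rfl fun i _ => hpdf (hstep i) _,
    Finset.prod_mul_distrib, Finset.prod_mul_distrib, Finset.prod_const, Finset.card_univ,
    Fintype.card_fin, ← Real.exp_sum, ← Finset.mul_sum, mul_add, Real.exp_add]
  ring

end Density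

/-! ### Splitting the event along the time grid -/

theorem exists_eq_or_mem_Ioo {α : Type*} [LinearOrder α] {n : ℕ} {t : Fin (n + 1) → α}
    {s : α} (h0 : t 0 ≤ s) (hn : s ≤ t (Fin.last n)) :
    (∃ j, s = t j) ∨ ∃ i : Fin n, s ∈ Set.Ioo (t i.castSucc) (t i.succ) := by
  suffices ∀ j, s ≤ t j →
      (∃ j, s = t j) ∨ ∃ i : Fin n, s ∈ Set.Ioo (t i.castSucc) (t i.succ) from this _ hn
  intro j
  induction j using Fin.induction with
  | zero => exact fun h => .inl ⟨0, h.antisymm h0⟩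
  | succ i ih =>
    intro h
    rcases le_or_gt s (t i.castSucc) with h1 | h1
    · exact ih h1
    · rcases h.eq_or_lt with h2 | h2
      · exact .inl ⟨_, h2⟩
      · exact .inr ⟨i, h1, h2⟩

namespace IsSlepianProcess

/-- The non-crossing event between two times is measurably determined by the values at these times
and by the bridge between them: by continuity only countably many times matter. -/
theorem exists_measurableSet_noncrossing {Ω : Type*} [MeasurableSpace Ω] {P : Measure Ω} {q d : ℝ}
    {W : Set.Icc q d → Ω → ℝ} (hW : IsSlepianProcess q d W P) (g : Set.Icc q d → ℝ)
    (a b : Set.Icc q d) :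
    ∃ C : Set ((ℝ × ℝ) × (Set.Ioo a b → ℝ)), MeasurableSet C ∧
      ∀ ω, ((W a ω, W b ω), fun s : Set.Ioo a b => bridge W a b s ω) ∈ C ↔
        ∀ s ∈ Set.Ioo a b, W s ω ≤ g s := by
  obtain ⟨S, hS, hSc, hSW⟩ := exists_countable_subset_forall_le_iff g (Set.Ioo a b)
  let S' : Set (Set.Ioo a b) := Subtype.val ⁻¹' S
  have hS' : S'.Countable := hSc.preimage Subtype.val_injective
  refine ⟨⋂ s ∈ S', {z | z.2 s + (((b : ℝ) - (s : Set.Icc q d)) / (b - a) * z.1.1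
    + (((s : Set.Icc q d) : ℝ) - a) / (b - a) * z.1.2) ≤ g s}, ?_, fun ω => ?_⟩
  · refine MeasurableSet.biInter hS' fun s _ => measurableSet_le ?_ measurable_const
    have : Measurable fun z : (ℝ × ℝ) × (Set.Ioo a b → ℝ) => z.2 s :=
      (measurable_pi_apply s).comp measurable_snd
    fun_prop
  · rw [← hSW _ (hW.continuous_paths ω)]
    simp only [Set.mem_iInter, Set.mem_ofPred_eq, bridge, sub_add_cancel]
    exact ⟨fun h s hs => h ⟨s, hS hs⟩ hs, fun h s hs => h s hs⟩

end IsSlepianProcess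

/-! ### The boundary crossing probability -/

theorem theorem1 {Ω : Type*} [MeasurableSpace Ω] (P : Measure Ω) [IsProbabilityMeasure P]
    (q d : ℝ) (hq : 0 < q) (hqd : q < d) (hd : d ≤ 2 * q)
    (W : Set.Icc q d → Ω → ℝ) (hW : IsSlepianProcess q d W P)
    (n : ℕ) (t : Fin (n + 1) → Set.Icc q d) (ht : StrictMono t)
    (ht0 : (t 0 : ℝ) = q) (htn : (t (Fin.last n) : ℝ) = d)
    (g : Set.Icc q d → ℝ) (hg : Measurable g)
    (p : Fin n → ℝ × ℝ → ℝ)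
    (hp : ∀ i : Fin n, IsCondProbGiven P
      {ω | ∀ s ∈ Set.Ioo (t i.castSucc) (t i.succ), W s ω ≤ g s}
      (fun ω => (W (t i.castSucc) ω, W (t i.succ) ω)) (p i)) :
    IntegrableOn (slepianIntegrand q d n (fun i => (t i : ℝ)) p)
      {x : Fin (n + 1) → ℝ | ∀ i, x i ≤ g (t i)} volume ∧
    P.real {ω | ∃ s : Set.Icc q d, g s < W s ω} =
      1 - slepianConst q d n
        * (∏ i ∈ Finset.univ.filter (fun i : Fin n => 0 < (i : ℕ)),
            Real.sqrt ((t i.succ : ℝ) - q) /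
              Real.sqrt (((t i.succ : ℝ) - (t i.castSucc : ℝ)) * ((t i.castSucc : ℝ) - q)))
        * ∫ x₀ in Set.Iic (g (t 0)),
            iteratedIntegralIic n (fun i : Fin n => g (t i.succ))
              (fun y => slepianIntegrand q d n (fun i => (t i : ℝ)) p
                (Fin.cons (α := fun _ => ℝ) x₀ y)) := by
  have htR : StrictMono fun i => (t i : ℝ) := ht
  set K : ℝ := slepianConst q d n
    * ∏ i ∈ Finset.univ.filter (fun i : Fin n => 0 < (i : ℕ)),
        Real.sqrt ((t i.succ : ℝ) - q) /
          Real.sqrt (((t i.succ : ℝ) - (t i.castSucc : ℝ)) * ((t i.castSucc : ℝ) - q))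
  set F := slepianIntegrand q d n (fun i => (t i : ℝ)) p with hF
  set f := IsSlepianProcess.skeletonDensity q d (fun i => (t i : ℝ))
  set B : Set (Fin (n + 1) → ℝ) := {x | ∀ i, x i ≤ g (t i)} with hB_def
  have hB : MeasurableSet B := measurableSet_Iic (a := fun i => g (t i))
  have hX : Measurable fun ω j => W (t j) ω := measurable_pi_lambda _ fun j => hW.measurable _
  have hfpos (x) : 0 < f x := mul_pos two_pos <| Finset.prod_pos fun i _ =>
    gaussianPDFReal_pos _ _ _
      (Real.toNNReal_pos.2 (IsSlepianProcess.endSumIncrementsVar_pos hq hd ht i)).ne'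
  have hfE (x) : f x = K * slepianIntegrand q d n (fun i => (t i : ℝ)) (fun _ _ => 1) x :=
    skeletonDensity_eq hq hd hqd htR ht0 htn x
  have hK0 : K ≠ 0 := fun h => (hfpos 0).ne' (by rw [hfE, h, zero_mul])
  have hfF (x) : f x * ∏ i : Fin n, p i (x i.castSucc, x i.succ) = K * F x := by
    rw [hfE, hF, slepianIntegrand_eq_prod_mul (p := p)]
    ring
  have hfm : Measurable f := by
    refine measurable_const.mul (Finset.measurable_prod _ fun i _ => ?_)
    exact (measurable_gaussianPDFReal _ _).comp ((measurable_pi_apply i).comp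
      (endSumIncrements n).continuous_of_finiteDimensional.measurable)
  have hlaw : P.map (fun ω j => W (t j) ω) = volume.withDensity fun x => ENNReal.ofReal (f x) :=
    hW.map_skeleton hq hd ht ht0 htn
  have hfint : Integrable f := by
    refine ⟨hfm.aestronglyMeasurable, ?_⟩
    rw [hasFiniteIntegral_iff_ofReal (.of_forall fun x => (hfpos x).le), ← setLIntegral_univ,
      ← withDensity_apply _ MeasurableSet.univ, ← hlaw]
    exact measure_lt_top _ _
  -- Conditionally on the values on the grid, the non-crossing events are independent.
  choose C hC hCW using fun i : Fin n =>
    hW.exists_measurableSet_noncrossing g (t i.castSucc) (t i.succ)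
  have hA (i : Fin n) : {ω | ∀ s ∈ Set.Ioo (t i.castSucc) (t i.succ), W s ω ≤ g s} =
      {ω | ((W (t i.castSucc) ω, W (t i.succ) ω), fun s : Set.Ioo (t i.castSucc) (t i.succ) =>
        IsSlepianProcess.bridge W (t i.castSucc) (t i.succ) s ω) ∈ C i} :=
    Set.ext fun ω => (hCW i ω).symm
  obtain ⟨hp01, hPB⟩ := measureReal_inter_iInter_eq_setIntegral_prod (P := P) hX
    (Y := fun (i : Fin n) (x : Fin (n + 1) → ℝ) => (x i.castSucc, x i.succ))
    (fun i => (measurable_pi_apply _).prodMk (measurable_pi_apply _))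
    (R := fun (i : Fin n) ω (s : Set.Ioo (t i.castSucc) (t i.succ)) =>
      IsSlepianProcess.bridge W (t i.castSucc) (t i.succ) s ω)
    (fun i => measurable_pi_lambda _ fun s => hW.measurable_bridge _ _ _)
    (hW.indepFun_skeleton_bridges hq hd ht) (hW.iIndepFun_bridges hq hd ht) hC (p := p)
    (fun i => hA i ▸ hp i) hB
  simp only [← hA] at hPB
  have hpm (i : Fin n) : Measurable fun x : Fin (n + 1) → ℝ => p i (x i.castSucc, x i.succ) :=
    (hp i).1.comp ((measurable_pi_apply _).prodMk (measurable_pi_apply _))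
  -- The density is positive, so that null sets for the law are Lebesgue null.
  have hp01' : ∀ᵐ x : Fin (n + 1) → ℝ, ∀ i : Fin n,
      p i (x i.castSucc, x i.succ) ∈ Set.Icc (0 : ℝ) 1 := by
    rw [hlaw] at hp01
    exact (withDensity_absolutelyContinuous' hfm.ennreal_ofReal.aemeasurable
      (.of_forall fun x => (ENNReal.ofReal_pos.2 (hfpos x)).ne')).ae_le hp01
  have hFint : Integrable F := by
    have h1 : Integrable fun x => f x * ∏ i : Fin n, p i (x i.castSucc, x i.succ) := by
      refine hfint.mul_bdd (c := 1) (Finset.measurable_prod _ fun i _ =>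
        hpm i).aestronglyMeasurable (hp01'.mono fun x hx => ?_)
      rw [Real.norm_of_nonneg (Finset.prod_nonneg fun i _ => (hx i).1)]
      exact Finset.prod_le_one (fun i _ => (hx i).1) fun i _ => (hx i).2
    simp only [hfF] at h1
    exact (integrable_const_mul_iff (isUnit_iff_ne_zero.2 hK0) F).1 h1
  refine ⟨hFint.integrableOn, ?_⟩
  have hcompl : {ω | ∃ s : Set.Icc q d, g s < W s ω} = ((fun ω j => W (t j) ω) ⁻¹' B ∩
      ⋂ i : Fin n, {ω | ∀ s ∈ Set.Ioo (t i.castSucc) (t i.succ), W s ω ≤ g s})ᶜ := by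
    ext ω
    rw [← not_iff_not]
    simp only [Set.mem_ofPred_eq, not_exists, not_lt, Set.mem_compl_iff, not_not, Set.mem_inter_iff,
      Set.mem_preimage, hB_def, Set.mem_iInter]
    refine ⟨fun h => ⟨fun i => h _, fun i s _ => h s⟩, fun h s => ?_⟩
    rcases exists_eq_or_mem_Ioo (t := t) (s := s)
      (Subtype.coe_le_coe.1 (ht0.trans_le s.2.1)) (Subtype.coe_le_coe.1 (s.2.2.trans_eq htn.symm))
      with ⟨j, rfl⟩ | ⟨i, hi⟩
    · exact h.1 j
    · exact h.2 i s hi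
  have hmeas : MeasurableSet ((fun ω j => W (t j) ω) ⁻¹' B ∩
      ⋂ i : Fin n, {ω | ∀ s ∈ Set.Ioo (t i.castSucc) (t i.succ), W s ω ≤ g s}) := by
    refine (hX hB).inter (MeasurableSet.iInter fun i => ?_)
    rw [hA]
    exact (((hW.measurable _).prodMk (hW.measurable _)).prodMk
      (measurable_pi_lambda _ fun s => hW.measurable_bridge _ _ _)) (hC i)
  have hiter : ∫ x₀ in Set.Iic (g (t 0)), iteratedIntegralIic n (fun i : Fin n => g (t i.succ))
      (fun y => F (Fin.cons (α := fun _ => ℝ) x₀ y)) = ∫ x in B, F x := by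
    obtain ⟨h1, h2⟩ := setIntegral_orthant_insertNth 0 (fun i => g (t i))
      (F := F) hFint.integrableOn
    rw [h2]
    refine setIntegral_congr_ae measurableSet_Iic (h1.mono fun z hz hzb => ?_)
    have := hz hzb
    simp only [Fin.succAbove_zero, Fin.insertNth_zero'] at this ⊢
    exact iteratedIntegralIic_eq_setIntegral _ _ _ this
  rw [hcompl, probReal_compl_eq_one_sub hmeas, hPB, hiter, hlaw,
    setIntegral_withDensity_eq_setIntegral_toReal_smul hfm.ennreal_ofReal
      (.of_forall fun _ => ENNReal.ofReal_lt_top) _ hB]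
  simp only [ENNReal.toReal_ofReal (hfpos _).le, smul_eq_mul, hfF]
  rw [integral_const_mul]
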